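/- A finite simple graph with vertex set $V$ is word-representable if there is a finite word $w$ over the alphabet $V$, containing each letter of $V$ at least once, such that any two distinct letters $x,y$ alternate in $w$ (i.e. erasing all other letters leaves $xyxy\cdots$ or $yxyx\cdots$, of even or odd length) if and only if $xy$ is an edge. For a binary $p\times q$ matrix $M$, let $G(M)$ be the split graph with adjacency matrix $\begin{bmatrix} L_q & M^T\\ M & O_p\end{bmatrix}$, where $L_q$ is the $q\times q$ matrix with $0$'s on the diagonal and $1$'s elsewhere and $O_p$ is the $p\times p$ zero matrix. For binary $m\times n$ matrices $A,B$, let $M^0(A,B)=[0]$, let $M^{k+1}(A,B)$ be obtained from $M^k(A,B)$ by replacing every entry $0$ by the block $A$ and every entry $1$ by the block $B$, and put $G^k(A,B)=G(M^k(A,B))$. Let $\mathrm{IWR}(A,B)$ be the smallest integer $l\ge 0$ such that $G^l(A,B)$ is not word-representable ($\infty$ if there is no such $l$). **Proposition.** Let $A=\begin{bmatrix}1&1\\1&1\end{bmatrix}$ and $B=\begin{bmatrix}0&0\\1&0\end{bmatrix}$. Then $G^k(A,B)$ is word-representable for every $0\le k\le 4$ and is not word-representable for every $k\ge 5$. Hence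 $\mathrm{IWR}(A,B)=5$. -/

import Mathlib

/-- Two letters `x` and `y` alternate in the word `w`: after erasing all other letters, no two
consecutive letters are equal (so what remains is `xyxy…` or `yxyx…`). -/
def Alternate {V : Type*} [DecidableEq V] (w : List V) (x y : V) : Prop :=
  (w.filter (fun z => z = x ∨ z = y)).IsChain (· ≠ ·)

/-- `G` is word-representable: some word, containing every vertex at least once, has the property
that two distinct letters alternate in it exactly when they are adjacent in `G`. -/
def WordRepresentable {V : Type*} [DecidableEq V] (G : SimpleGraph V) : Prop :=
  ∃ w : List V, (∀ v, v ∈ w) ∧ ∀ x y, x ≠ y → (Alternate w x y ↔ G.Adj x y)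

/-- Binary matrices. -/
abbrev BinMatrix (m n : ℕ) : Type := Matrix (Fin m) (Fin n) (Fin 2)

/-- The `n × n` matrix `L_n` with zeros on the diagonal and ones elsewhere. -/
def cliqueMatrix (n : ℕ) : BinMatrix n n :=
  Matrix.of fun i j => if i = j then 0 else 1

/-- The block matrix `S(M) = [L_n, Mᵀ; M, 0]`. -/
def splitMatrix {m n : ℕ} (M : BinMatrix m n) :
    Matrix (Fin n ⊕ Fin m) (Fin n ⊕ Fin m) (Fin 2) :=
  Matrix.fromBlocks (cliqueMatrix n) M.transpose M 0

theorem splitMatrix_symm {m n : ℕ} (M : BinMatrix m n) (u v : Fin n ⊕ Fin m) :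
    splitMatrix M u v = splitMatrix M v u := by
  rcases u with i | i <;> rcases v with j | j <;>
    simp [splitMatrix, cliqueMatrix, eq_comm]

theorem splitMatrix_diag {m n : ℕ} (M : BinMatrix m n) (u : Fin n ⊕ Fin m) :
    splitMatrix M u u = 0 := by
  rcases u with i | i <;> simp [splitMatrix, cliqueMatrix]

/-- The split graph `G(M)` with adjacency matrix `S(M)`. -/
def splitGraph {m n : ℕ} (M : BinMatrix m n) : SimpleGraph (Fin n ⊕ Fin m) where
  Adj u v := splitMatrix M u v = 1
  symm := ⟨fun u v h => by rw [splitMatrix_symm]; exact h⟩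
  loopless := ⟨fun u h => by rw [splitMatrix_diag] at h; exact absurd h (by decide)⟩

/-- The two-dimensional morphism `0 ↦ A`, `1 ↦ B`, applied to a `p × q` binary matrix `M`: every
entry of `M` is replaced by the corresponding `m × n` block. -/
def morphism {m n p q : ℕ} (A B : BinMatrix m n) (M : BinMatrix p q) :
    BinMatrix (p * m) (q * n) :=
  Matrix.of fun i j =>
    (if M i.divNat j.divNat = 0 then A else B) i.modNat j.modNat

/-- `M^k(A,B)`: the `k`-th iterate of the morphism `0 ↦ A`, `1 ↦ B`, starting from `[0]`. -/
def iterMatrix {m n : ℕ} (A B : BinMatrix m n) : (k : ℕ) → BinMatrix (m ^ k) (n ^ k)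
  | 0 => Matrix.of fun _ _ => 0
  | k + 1 => morphism A B (iterMatrix A B k)

/-- The split graph `G^k(A,B)`, with adjacency matrix `S(M^k(A,B))`. -/
def iterGraph {m n : ℕ} (A B : BinMatrix m n) (k : ℕ) :
    SimpleGraph (Fin (n ^ k) ⊕ Fin (m ^ k)) :=
  splitGraph (iterMatrix A B k)

/-- The index of word-representability: the smallest `l` such that `G^l(A,B)` is not
word-representable, and `⊤` if there is none. -/
noncomputable def IWR {m n : ℕ} (A B : BinMatrix m n) : ℕ∞ :=
  sInf {l : ℕ∞ | ∃ k : ℕ, l = k ∧ ¬ WordRepresentable (iterGraph A B k)}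

/-! Two letters alternate exactly when one of their prefix counts always exceeds the other by 0 or 1
(`alternate_iff_compatible`). Each pair of clique letters is thus oriented, and any four line up in
a chain `p, q, r, s`, each leading the next. No count is compatible with `p` and `r` but not with
`q` and `s`, nor the other way round. Hence, of the three splittings of four clique vertices into
two pairs, at least one is realised by no independent vertex, on either side
(`not_separated_pairs`).

For `k ≥ 5` the bottom-left `16 × 16` block of the matrix grows from a single entry 1, and three of
its rows realise all three splittings of columns 0, 3, 5, 6. For `k ≤ 4` explicit words are checked
by computation. -/

/-! ### Alternation in terms of prefix counts -/

/-- `g ≤ f ≤ g + 1` pointwise. -/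
def Leads (f g : ℕ → ℕ) : Prop := ∀ n, g n ≤ f n ∧ f n ≤ g n + 1

/-- One of the two functions leads the other. -/
def Compatible (f g : ℕ → ℕ) : Prop := Leads f g ∨ Leads g f

/-- The number of occurrences of `x` among the first `n` letters of `w`. -/
def prefixCount {V : Type*} [DecidableEq V] (w : List V) (x : V) (n : ℕ) : ℕ :=
  (w.take n).count x

theorem leads_cons_of_ne {V : Type*} [DecidableEq V] {w : List V} {x y z : V}
    (hx : z ≠ x) (hy : z ≠ y) :
    Leads (prefixCount (z :: w) x) (prefixCount (z :: w) y) ↔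
      Leads (prefixCount w x) (prefixCount w y) := by
  constructor
  · intro h n
    simpa [prefixCount, List.count_cons_of_ne hx, List.count_cons_of_ne hy] using h (n + 1)
  · rintro h (_ | n)
    · simp [prefixCount]
    · simpa [prefixCount, List.count_cons_of_ne hx, List.count_cons_of_ne hy] using h n

theorem leads_cons_self {V : Type*} [DecidableEq V] {w : List V} {x y : V} (hxy : x ≠ y) :
    Leads (prefixCount (x :: w) x) (prefixCount (x :: w) y) ↔
      Leads (prefixCount w y) (prefixCount w x) := by
  constructor
  · intro h n
    have := h (n + 1)
    simp only [prefixCount, List.take_succ_cons, List.count_cons_self,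
      List.count_cons_of_ne hxy] at this ⊢
    omega
  · rintro h (_ | n)
    · simp [prefixCount]
    · have := h n
      simp only [prefixCount, List.take_succ_cons, List.count_cons_self,
        List.count_cons_of_ne hxy] at this ⊢
      omega

theorem not_leads_cons_self {V : Type*} [DecidableEq V] {w : List V} {x y : V} (hxy : x ≠ y) :
    ¬ Leads (prefixCount (y :: w) x) (prefixCount (y :: w) y) := by
  intro h
  have := h 1
  simp [prefixCount, hxy.symm] at this

/-- The prepended `y` forbids `y` as the first surviving letter, which turns symmetric alternation
into an oriented relation. Reading `x` exchanges the two roles, hence the quantification over both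
letters in the induction. -/
theorem isChain_cons_filter_iff_leads {V : Type*} [DecidableEq V] (w : List V) :
    ∀ x y : V, x ≠ y → ((y :: w.filter (fun z => z = x ∨ z = y)).IsChain (· ≠ ·) ↔
      Leads (prefixCount w x) (prefixCount w y)) := by
  induction w with
  | nil =>
    intro x y _
    simp [prefixCount, Leads]
  | cons z w ih =>
    intro x y hxy
    by_cases hx : z = x
    · subst hx
      rw [leads_cons_self hxy, ← ih y z hxy.symm]
      simp [hxy.symm, or_comm]
    · by_cases hy : z = y
      · subst hy
        simp [not_leads_cons_self hxy]
      · rw [leads_cons_of_ne hx hy, ← ih x y hxy]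
        simp [hx, hy]

theorem alternate_iff_compatible {V : Type*} [DecidableEq V] (w : List V) {x y : V}
    (hxy : x ≠ y) :
    Alternate w x y ↔ Compatible (prefixCount w x) (prefixCount w y) := by
  have h₁ := isChain_cons_filter_iff_leads w x y hxy
  have h₂ := isChain_cons_filter_iff_leads w y x hxy.symm
  simp only [or_comm (b := _ = x)] at h₂
  rw [Compatible, ← h₁, ← h₂, Alternate]
  cases hF : w.filter (fun z => z = x ∨ z = y) with
  | nil => simp
  | cons a l =>
    have ha : a = x ∨ a = y := by
      have : a ∈ w.filter (fun z => z = x ∨ z = y) := by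
        rw [hF]
        exact List.mem_cons_self
      simpa using (List.mem_filter.1 this).2
    rcases ha with rfl | rfl
    · simp [hxy.symm]
    · simp [hxy]

/-! ### Four pairwise compatible functions -/

/-- Some function is compatible with `p` and `r`, but neither with `q` nor with `s`. -/
def Separated (p r q s : ℕ → ℕ) : Prop :=
  ∃ x, Compatible x p ∧ Compatible x r ∧ ¬ Compatible x q ∧ ¬ Compatible x s

theorem Separated.swap {p r q s : ℕ → ℕ} (h : Separated p r q s) : Separated r p q s := by
  obtain ⟨x, h₁, h₂, h₃, h₄⟩ := h
  exact ⟨x, h₂, h₁, h₃, h₄⟩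

theorem Separated.swap_right {p r q s : ℕ → ℕ} (h : Separated p r q s) :
    Separated p r s q := by
  obtain ⟨x, h₁, h₂, h₃, h₄⟩ := h
  exact ⟨x, h₁, h₂, h₄, h₃⟩

/-- In the opposite orientation, `p ≥ q ≥ r ≥ s ≥ p` forces all four to coincide. -/
theorem Leads.of_chain {p q r s : ℕ → ℕ} (hpq : Leads p q) (hqr : Leads q r) (hrs : Leads r s)
    (hps : Compatible p s) : Leads p s := by
  rcases hps with h | h
  · exact h
  · intro n
    have := hpq n
    have := hqr n
    have := hrs n
    have := h n
    omega

/-- Compatibility with `p` and `r` pinches `x` close enough to `q` or to `s` to be compatible with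
it. -/
theorem not_separated_odd {p q r s : ℕ → ℕ} (hpq : Leads p q) (hqr : Leads q r)
    (hrs : Leads r s) (hps : Compatible p s) : ¬ Separated p r q s := by
  have hps := hpq.of_chain hqr hrs hps
  rintro ⟨x, hp | hp, hr | hr, hq, hs⟩
  · refine hq (.inl fun n => ?_)
    have := hpq n; have := hqr n; have := hp n; have := hr n
    omega
  · refine hq (.inl fun n => ?_)
    have := hpq n; have := hqr n; have := hp n; have := hr n
    omega
  · refine hs (.inl fun n => ?_)
    have := hrs n; have := hps n; have := hp n; have := hr n
    omega
  · refine hq (.inr fun n => ?_)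
    have := hpq n; have := hqr n; have := hp n; have := hr n
    omega

theorem not_separated_even {p q r s : ℕ → ℕ} (hpq : Leads p q) (hqr : Leads q r)
    (hrs : Leads r s) (hps : Compatible p s) : ¬ Separated q s p r := by
  have hps := hpq.of_chain hqr hrs hps
  rintro ⟨x, hq | hq, hs | hs, hp, hr⟩
  · refine hr (.inl fun n => ?_)
    have := hqr n; have := hrs n; have := hq n; have := hs n
    omega
  · refine hr (.inl fun n => ?_)
    have := hqr n; have := hrs n; have := hq n; have := hs n
    omega
  · refine hp (.inr fun n => ?_)
    have := hpq n; have := hps n; have := hq n; have := hs n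
    omega
  · refine hr (.inr fun n => ?_)
    have := hqr n; have := hrs n; have := hq n; have := hs n
    omega

theorem not_separated_pairs {a b c d : ℕ → ℕ} (hab : Compatible a b) (hac : Compatible a c)
    (had : Compatible a d) (hbc : Compatible b c) (hbd : Compatible b d) (hcd : Compatible c d)
    (h₁ : Separated a b c d) (h₂ : Separated a d b c) (h₃ : Separated b d a c) : False := by
  have symm : ∀ {f g : ℕ → ℕ}, Compatible f g → Compatible g f := Or.symm
  have key : ∀ p q r s, Leads p q → Leads q r → Leads r s → Compatible p s →
      ¬ Separated p r q s ∧ ¬ Separated q s p r := fun p q r s h h' h'' h''' =>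
    ⟨not_separated_odd h h' h'' h''', not_separated_even h h' h'' h'''⟩
  have s₁ := h₁.swap
  have s₂ := h₂.swap
  have s₃ := h₃.swap
  have t₁ := h₁.swap_right
  have t₂ := h₂.swap_right
  have t₃ := h₃.swap_right
  have u₁ := s₁.swap_right
  have u₂ := s₂.swap_right
  have u₃ := s₃.swap_right
  have hba := symm hab
  have hca := symm hac
  have hda := symm had
  have hcb := symm hbc
  have hdb := symm hbd
  have hdc := symm hcd
  have := hab; have := hac; have := had; have := hbc; have := hbd; have := hcd
  clear symm
  -- A tournament on four vertices has a Hamiltonian path, so every orientation provides a chain for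
  -- `key`; the splitting into alternate members of that chain is one of the three assumed.
  rcases hab with l₁ | l₁ <;> rcases hac with l₂ | l₂ <;> rcases had with l₃ | l₃ <;>
    rcases hbc with l₄ | l₄ <;> rcases hbd with l₅ | l₅ <;> rcases hcd with l₆ | l₆ <;> grind

/-! ### The entries of the iterated matrices -/

/-- The entries of `M^k(A,B)`, as a function of natural number indices. -/
def entry : ℕ → ℕ → ℕ → Bool
  | 0, _, _ => false
  | k + 1, i, j => !entry k (i / 2) (j / 2) || (i % 2 == 1 && j % 2 == 0)

theorem iterMatrix_eq_one_iff (k : ℕ) (i j : Fin (2 ^ k)) :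
    iterMatrix (!![1, 1; 1, 1] : BinMatrix 2 2) (!![0, 0; 1, 0] : BinMatrix 2 2) k i j = 1 ↔
      entry k i j = true := by
  induction k with
  | zero => simp [iterMatrix, entry]
  | succ k ih =>
    have h := ih (Fin.divNat (m := 2 ^ k) (n := 2) i) (Fin.divNat (m := 2 ^ k) (n := 2) j)
    have key : ∀ (e : Fin 2) (b : Bool) (r s : Fin 2), (e = 1 ↔ b = true) →
        ((if e = 0 then (!![1, 1; 1, 1] : BinMatrix 2 2) else !![0, 0; 1, 0]) r s = 1 ↔
          (!b || (r.val == 1 && s.val == 0)) = true) := by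
      intro e b r s h
      fin_cases e <;> fin_cases r <;> fin_cases s <;> cases b <;> simp_all
    exact key _ _ (Fin.modNat (m := 2 ^ k) (n := 2) i) (Fin.modNat (m := 2 ^ k) (n := 2) j) h

theorem splitGraph_adj_iff (k : ℕ) (u v : Fin (2 ^ k) ⊕ Fin (2 ^ k)) :
    (iterGraph (!![1, 1; 1, 1] : BinMatrix 2 2) (!![0, 0; 1, 0] : BinMatrix 2 2) k).Adj u v ↔
      match u, v with
      | .inl i, .inl j => i ≠ j
      | .inl i, .inr j => entry k j i = true
      | .inr i, .inl j => entry k i j = true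
      | .inr _, .inr _ => False := by
  rcases u with i | i <;> rcases v with j | j <;>
    simp [iterGraph, splitGraph, splitMatrix, cliqueMatrix, iterMatrix_eq_one_iff]

/-- Both `A` and `B` have 1 in the bottom-left corner, so one step of the morphism already puts a 1
there for good. -/
theorem entry_last_zero (k : ℕ) : entry (k + 1) (2 ^ (k + 1) - 1) 0 = true := by
  have h : (2 ^ (k + 1) - 1) % 2 = 1 := by
    have := Nat.one_le_two_pow (n := k)
    rw [pow_succ]
    omega
  simp [entry, h]

theorem entry_add_four {k I : ℕ} (h : entry k I 0 = true) {a b : ℕ} (ha : a < 16)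
    (hb : b < 16) : entry (k + 4) (16 * I + a) b =
      (!(!(!(!true || (a / 2 / 2 / 2 % 2 == 1 && b / 2 / 2 / 2 % 2 == 0)) ||
        (a / 2 / 2 % 2 == 1 && b / 2 / 2 % 2 == 0)) ||
        (a / 2 % 2 == 1 && b / 2 % 2 == 0)) || (a % 2 == 1 && b % 2 == 0)) := by
  have h₀ : (16 * I + a) % 2 = a % 2 := by omega
  have h₁ : (16 * I + a) / 2 % 2 = a / 2 % 2 := by omega
  have h₂ : (16 * I + a) / 2 / 2 % 2 = a / 2 / 2 % 2 := by omega
  have h₃ : (16 * I + a) / 2 / 2 / 2 % 2 = a / 2 / 2 / 2 % 2 := by omega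
  have h₄ : (16 * I + a) / 2 / 2 / 2 / 2 = I := by omega
  have h₅ : b / 2 / 2 / 2 / 2 = 0 := by omega
  simp only [entry, h₀, h₁, h₂, h₃, h₄, h₅, h]

theorem not_wordRepresentable_of_five_le (k : ℕ) (hk : 5 ≤ k) : ¬ WordRepresentable
    (iterGraph (!![1, 1; 1, 1] : BinMatrix 2 2) (!![0, 0; 1, 0] : BinMatrix 2 2) k) := by
  -- At least one step makes the corner entry 1; four more expand it to a `16 × 16` block.
  obtain ⟨l, rfl⟩ : ∃ l, k = l + 1 + 4 := ⟨k - 5, by omega⟩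
  rintro ⟨w, -, hw⟩
  have hpos := Nat.one_le_two_pow (n := l + 1)
  have hpow : 2 ^ (l + 1 + 4) = 16 * 2 ^ (l + 1) := by rw [pow_add]; ring
  set I := 2 ^ (l + 1) - 1 with hI
  have hent {a b : ℕ} (ha : a < 16) (hb : b < 16) :=
    entry_add_four (entry_last_zero l) ha hb
  rw [← hI] at hent
  let col (b : ℕ) (hb : b < 16) : Fin (2 ^ (l + 1 + 4)) ⊕ Fin (2 ^ (l + 1 + 4)) :=
    .inl ⟨b, by omega⟩
  let row (a : ℕ) (ha : a < 16) : Fin (2 ^ (l + 1 + 4)) ⊕ Fin (2 ^ (l + 1 + 4)) :=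
    .inr ⟨16 * I + a, by omega⟩
  have hcol (a b : ℕ) (ha : a < 16) (hb : b < 16) (hab : a ≠ b) :
      Compatible (prefixCount w (col a ha)) (prefixCount w (col b hb)) := by
    have hne : col a ha ≠ col b hb := by simpa [col] using hab
    rw [← alternate_iff_compatible w hne, hw _ _ hne, splitGraph_adj_iff]
    simpa [col] using hab
  have hrow (a b : ℕ) (ha : a < 16) (hb : b < 16) :
      Compatible (prefixCount w (row a ha)) (prefixCount w (col b hb)) ↔
        entry (l + 1 + 4) (16 * I + a) b = true := by
    have hne : row a ha ≠ col b hb := by simp [row, col]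
    rw [← alternate_iff_compatible w hne, hw _ _ hne, splitGraph_adj_iff]
  have hsep (a p r q s : ℕ) (ha : a < 16) (hp : p < 16) (hr : r < 16) (hq : q < 16)
      (hs : s < 16) (h₁ : entry (l + 1 + 4) (16 * I + a) p = true)
      (h₂ : entry (l + 1 + 4) (16 * I + a) r = true)
      (h₃ : entry (l + 1 + 4) (16 * I + a) q = false)
      (h₄ : entry (l + 1 + 4) (16 * I + a) s = false) :
      Separated (prefixCount w (col p hp)) (prefixCount w (col r hr))
        (prefixCount w (col q hq)) (prefixCount w (col s hs)) :=
    ⟨prefixCount w (row a ha), (hrow a p ha hp).2 h₁, (hrow a r ha hr).2 h₂,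
      by simp [hrow a q ha hq, h₃], by simp [hrow a s ha hs, h₄]⟩
  -- Within the block, rows 12, 9 and 2 have ones at the first pair and zeros at the second in the
  -- splittings 03|56, 06|35 and 36|05.
  refine not_separated_pairs
    (hcol 0 3 (by omega) (by omega) (by omega)) (hcol 0 5 (by omega) (by omega) (by omega))
    (hcol 0 6 (by omega) (by omega) (by omega)) (hcol 3 5 (by omega) (by omega) (by omega))
    (hcol 3 6 (by omega) (by omega) (by omega)) (hcol 5 6 (by omega) (by omega) (by omega))
    (hsep 12 0 3 5 6 (by omega) (by omega) (by omega) (by omega)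
      (by omega) ?_ ?_ ?_ ?_)
    (hsep 9 0 6 3 5 (by omega) (by omega) (by omega) (by omega)
      (by omega) ?_ ?_ ?_ ?_)
    (hsep 2 3 6 0 5 (by omega) (by omega) (by omega) (by omega)
      (by omega) ?_ ?_ ?_ ?_) <;>
    exact (hent (by omega) (by omega)).trans (by decide)

/-! ### Words for small exponents -/

/-- The vertices of `G^k` coded by the numbers below `2 ^ k + 2 ^ k`, clique first. -/
def vertexCode (k : ℕ) (v : Fin (2 ^ k) ⊕ Fin (2 ^ k)) : ℕ :=
  finSumFinEquiv v

theorem vertexCode_injective (k : ℕ) : Function.Injective (vertexCode k) :=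
  Fin.val_injective.comp finSumFinEquiv.injective

/-- Adjacency of the coded vertices `x < y`. -/
def codeAdj (k x y : ℕ) : Bool :=
  if y < 2 ^ k then true else if x < 2 ^ k then entry k (y - 2 ^ k) x else false

theorem Alternate.comm {V : Type*} [DecidableEq V] {w : List V} {x y : V} :
    Alternate w x y ↔ Alternate w y x := by
  simp only [Alternate, or_comm]

theorem alternate_map {V W : Type*} [DecidableEq V] [DecidableEq W] {f : V → W}
    (hf : Function.Injective f) (w : List V) (x y : V) :
    Alternate (w.map f) (f x) (f y) ↔ Alternate w x y := by
  simp [Alternate, List.filter_map, List.isChain_map, Function.comp_def, hf.eq_iff]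

theorem adj_iff_codeAdj (k : ℕ) {u v : Fin (2 ^ k) ⊕ Fin (2 ^ k)}
    (huv : vertexCode k u < vertexCode k v) :
    (iterGraph (!![1, 1; 1, 1] : BinMatrix 2 2) (!![0, 0; 1, 0] : BinMatrix 2 2) k).Adj u v ↔
      codeAdj k (vertexCode k u) (vertexCode k v) = true := by
  rw [splitGraph_adj_iff]
  rcases u with ⟨i, hi⟩ | ⟨i, hi⟩ <;> rcases v with ⟨j, hj⟩ | ⟨j, hj⟩ <;>
    simp_all [vertexCode, codeAdj] <;> omega

/-- Coding vertices by numbers leaves a finite check that the kernel can evaluate. -/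
theorem wordRepresentable_of_code (k : ℕ) (w : List ℕ) (hlt : ∀ x ∈ w, x < 2 ^ k + 2 ^ k)
    (hmem : ∀ x < 2 ^ k + 2 ^ k, x ∈ w)
    (halt : ∀ y < 2 ^ k + 2 ^ k, ∀ x < y,
      ((w.filter fun z => z = x ∨ z = y).IsChain (· ≠ ·) ↔ codeAdj k x y = true)) :
    WordRepresentable
      (iterGraph (!![1, 1; 1, 1] : BinMatrix 2 2) (!![0, 0; 1, 0] : BinMatrix 2 2) k) := by
  obtain ⟨w, rfl⟩ : ∃ w' : List (Fin (2 ^ k) ⊕ Fin (2 ^ k)), w'.map (vertexCode k) = w := by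
    refine ⟨w.pmap (fun x hx => finSumFinEquiv.symm (⟨x, hx⟩ : Fin (2 ^ k + 2 ^ k))) hlt, ?_⟩
    simp [List.map_pmap, vertexCode]
  have hcode (v) : vertexCode k v < 2 ^ k + 2 ^ k := (finSumFinEquiv v).isLt
  have hmain (u v) (huv : vertexCode k u < vertexCode k v) : Alternate w u v ↔
      (iterGraph (!![1, 1; 1, 1] : BinMatrix 2 2) (!![0, 0; 1, 0] : BinMatrix 2 2) k).Adj
        u v := by
    rw [adj_iff_codeAdj k huv, ← halt _ (hcode v) _ huv,
      ← alternate_map (vertexCode_injective k) w u v, Alternate]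
  refine ⟨w, fun v => ?_, fun u v huv => ?_⟩
  · exact (List.mem_map_of_injective (vertexCode_injective k)).1 (hmem _ (hcode v))
  · rcases lt_or_gt_of_ne ((vertexCode_injective k).ne huv) with h | h
    · exact hmain u v h
    · rw [Alternate.comm, SimpleGraph.adj_comm, hmain v u h]

theorem wordRepresentable_of_le_four (k : ℕ) (hk : k ≤ 4) : WordRepresentable
    (iterGraph (!![1, 1; 1, 1] : BinMatrix 2 2) (!![0, 0; 1, 0] : BinMatrix 2 2) k) := by
  interval_cases k
  -- A letter doubled on the spot alternates with no other, so it stands for an isolated vertex: 1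
  -- here, 4 and 6 for exponent 2.
  · apply wordRepresentable_of_code 0 [1, 1, 0] <;> decide +kernel
  · apply wordRepresentable_of_code 1 [2, 3, 0, 1, 3, 2] <;> decide +kernel
  · apply wordRepresentable_of_code 2 [4, 4, 5, 6, 6, 7, 0, 2, 7, 5, 1, 3] <;> decide +kernel
  · apply wordRepresentable_of_code 3
      [14, 0, 4, 15, 1, 13, 9, 11, 8, 12, 5, 10, 2, 6, 3, 7, 10, 0, 4, 11, 1, 12, 8, 9, 13,
      5, 15, 14, 2, 6, 3, 7, 0, 10, 4, 14, 15, 1, 9, 13, 8, 12, 5, 11, 2, 6, 3, 7] <;> decide +kernel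
  · apply wordRepresentable_of_code 4
      [24, 16, 18, 16, 26, 24, 26, 0, 22, 8, 30, 2, 10, 25, 27, 3, 11, 1, 9, 21, 20, 29,
      31, 5, 13, 7, 15, 28, 23, 17, 19, 4, 12, 6, 14, 26, 0, 8, 30, 22, 2, 10, 25, 19, 3,
      11, 30, 1, 23, 9, 28, 29, 20, 5, 21, 13, 7, 15, 17, 27, 31, 4, 12, 6, 14, 16, 18,
      16, 24, 0, 8, 22, 2, 10, 3, 11, 22, 31, 23, 30, 1, 9, 21, 29, 20, 5, 27, 17, 13, 28,
      7, 15, 25, 19, 4, 24, 12, 6, 14, 24, 26, 18, 0, 8, 2, 10, 27, 17, 3, 19, 11, 30, 31,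
      23, 1, 25, 9, 5, 13, 7, 15, 21, 29, 4, 22, 12, 6, 14, 18, 28, 20, 16, 26] <;> decide +kernel

theorem mainTheorem10 :
    (∀ k : ℕ, k ≤ 4 → WordRepresentable
      (iterGraph (!![1, 1; 1, 1] : BinMatrix 2 2) (!![0, 0; 1, 0] : BinMatrix 2 2) k)) ∧
    (∀ k : ℕ, 5 ≤ k → ¬ WordRepresentable
      (iterGraph (!![1, 1; 1, 1] : BinMatrix 2 2) (!![0, 0; 1, 0] : BinMatrix 2 2) k)) ∧
    IWR (!![1, 1; 1, 1] : BinMatrix 2 2) (!![0, 0; 1, 0] : BinMatrix 2 2) = 5 := by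
  refine ⟨wordRepresentable_of_le_four, not_wordRepresentable_of_five_le, le_antisymm ?_ ?_⟩
  · exact sInf_le ⟨5, rfl, not_wordRepresentable_of_five_le 5 le_rfl⟩
  · refine le_sInf ?_
    rintro _ ⟨k, rfl, hk⟩
    have : 5 ≤ k := by
      by_contra h
      exact hk (wordRepresentable_of_le_four k (by omega))
    exact_mod_cast this
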